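/- Let $G$ be a finite group, let $V$ be a finite-dimensional complex inner product space of dimension $d_\rho$, let $\rho: G\to \mathsf U(V)$ be an irreducible unitary representation, and let $d_\psi$ be an integer with $1\le d_\psi\le d_\rho$. For an orthogonal projection $\Pi$ of $V$ of rank $d_\psi$ with range $W$, define $\psi=\psi_\Pi: G\to \mathrm{End}(W)$ by \[ \psi(x)=\sqrt{\frac{d_\rho}{d_\psi}}\;\Pi\rho(x)\Pi , \] regarded as an operator on $W$. Whenever $\psi(x)$ is invertible on $W$, let $\tilde\psi(x)=\psi(x)\,(\psi(x)^\dagger\psi(x))^{-1/2}\in\mathsf U(W)$ be the unitary part of its polar decomposition. Write $\|A\|_{\mathrm F}^2=\operatorname{tr}A^\dagger A$, and let $\mathbb E_{x,y}$ be the average over independent uniform $x,y\in G$. (1) Let $\Pi=U^\dagger\Pi' U$, where $\Pi'$ is any fixed orthogonal projection of rank $d_\psi$ and $U\in\mathsf U(V)$ is distributed according to the Haar probability measure. Then almost surely $\psi(x)$ is invertible on $W$ for all $x\in G$, so that $\tilde\psi$ is almost surely defined, the expectation below exists, and \[ \mathbb E_\Pi\,\mathbb E_{x,y\in G}\,\bigl\|\tilde\psi(xy)-\tilde\psi(x)\tilde\psi(y)\bigr\|_{\mathrm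 F}^2\;\le\; 2d_\psi\left(4\Bigl(1-\sqrt{\tfrac{d_\psi}{d_\rho}}\Bigr)+6\Bigl(1-\tfrac{d_\psi}{d_\rho}\Bigr)\right). \] (2) Hence there is a particular orthogonal projection $\Pi$ of rank $d_\psi$ for which every $\psi(x)$ is invertible on $W$, every $\tilde\psi(x)$ is unitary on $W$, and \[ \mathbb E_{x,y\in G}\,\bigl\|\tilde\psi(xy)-\tilde\psi(x)\tilde\psi(y)\bigr\|_{\mathrm F}^2\;\le\; 2d_\psi\left(4\Bigl(1-\sqrt{\tfrac{d_\psi}{d_\rho}}\Bigr)+6\Bigl(1-\tfrac{d_\psi}{d_\rho}\Bigr)\right). \] If moreover $d_\psi/d_\rho>\frac{31-2\sqrt{58}}{18}=0.876\ldots$, then for this $\Pi$ \[ \frac1{2d_\psi}\,\mathbb E_{x,y\in G}\,\bigl\|\tilde\psi(xy)-\tilde\psi(x)\tilde\psi(y)\bigr\|_{\mathrm F}^2\le\alpha \quad\text{with}\quad \alpha=4\Bigl(1-\sqrt{\tfrac{d_\psi}{d_\rho}}\Bigr)+6\Bigl(1-\tfrac{d_\psi}{d_\rho}\Bigr)<1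 . \] -/

import Mathlib

open MeasureTheory Module

noncomputable section

namespace ApproxRep

section Operators

variable {V : Type*} [NormedAddCommGroup V] [InnerProductSpace ℂ V]

/-- The squared Frobenius norm `‖A‖_F² = tr (A† A)` of an operator on a finite-dimensional
complex inner product space. -/
def frobSq [CompleteSpace V] (A : V →L[ℂ] V) : ℝ :=
  (LinearMap.trace ℂ V (star A * A : V →L[ℂ] V).toLinearMap).re

/-- The unitary part `A (A† A)^{-1/2}` of the polar decomposition of an operator `A` of full
rank; the power is taken in the continuous functional calculus. -/
def polarUnitary [CompleteSpace V] (A : V →L[ℂ] V) : V →L[ℂ] V :=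
  A * (star A * A) ^ (-(1 / 2) : ℝ)

/-- `P` is an orthogonal projection operator on `V` of rank `d`. -/
def IsProjectionOfRank [CompleteSpace V] (P : V →L[ℂ] V) (d : ℕ) : Prop :=
  IsStarProjection P ∧ finrank ℂ P.range = d

/-- The operator `P T P`, regarded as an operator on the range `W` of `P`. -/
def compress (P T : V →L[ℂ] V) : P.range →L[ℂ] P.range :=
  ((P * T * P).comp P.range.subtypeL).codRestrict P.range
    (fun w => ⟨T (P w), rfl⟩)

/-- The conjugate `U† P U`. -/
def conjBy [CompleteSpace V] (U : unitary (V →L[ℂ] V)) (P : V →L[ℂ] V) : V →L[ℂ] V :=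
  star (U : V →L[ℂ] V) * P * (U : V →L[ℂ] V)

instance compactSpace_unitary [FiniteDimensional ℂ V] [CompleteSpace V] :
    CompactSpace (unitary (V →L[ℂ] V)) := by
  have : ProperSpace (V →L[ℂ] V) := FiniteDimensional.proper_rclike ℂ _
  refine isCompact_iff_compactSpace.mp
    (Metric.isCompact_of_isClosed_isBounded isClosed_unitary ?_)
  refine (Metric.isBounded_closedBall (x := (0 : V →L[ℂ] V)) (r := 1)).subset ?_
  intro U hU
  rw [mem_closedBall_zero_iff]
  rcases subsingleton_or_nontrivial (V →L[ℂ] V) with h | h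
  · rw [Subsingleton.elim U 0, norm_zero]
    exact zero_le_one
  · exact (CStarRing.norm_of_mem_unitary hU).le

/-- The Haar probability measure on the unitary group `U(V)` (normalized so that the whole
compact group has measure `1`). -/
def unitaryHaar (V : Type*) [NormedAddCommGroup V] [InnerProductSpace ℂ V]
    [FiniteDimensional ℂ V] [CompleteSpace V] : Measure (unitary (V →L[ℂ] V)) :=
  Measure.haarMeasure ⊤

end Operators

section Representations

variable {G : Type*} [Group G]
  {V : Type*} [NormedAddCommGroup V] [InnerProductSpace ℂ V] [CompleteSpace V]

/-- The linear representation underlying a homomorphism `ρ : G → U(V)`. -/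
def toRepresentation (ρ : G →* unitary (V →L[ℂ] V)) : Representation ℂ G V :=
  (ContinuousLinearMap.toLinearMapRingHom : (V →L[ℂ] V) →+* (V →ₗ[ℂ] V)).toMonoidHom.comp
    ((unitary (V →L[ℂ] V)).subtype.comp ρ)

/-- The scaled minor `ψ(x) = √(d_ρ / d_ψ) P ρ(x) P`, an operator on the range `W` of `P`, where
`d_ρ = dim V` and `d_ψ = dim W`. -/
def minor (ρ : G →* unitary (V →L[ℂ] V)) (P : V →L[ℂ] V) (x : G) : P.range →L[ℂ] P.range :=
  ((√((finrank ℂ V : ℝ) / (finrank ℂ P.range : ℝ)) : ℝ) : ℂ) •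
    compress P (ρ x : V →L[ℂ] V)

/-- The unitary part `ψ̃(x)` of the polar decomposition of the scaled minor `ψ(x)`, taken in the
operators on `W`. -/
def polarMinor [FiniteDimensional ℂ V] (ρ : G →* unitary (V →L[ℂ] V)) (P : V →L[ℂ] V) (x : G) :
    P.range →L[ℂ] P.range :=
  polarUnitary (minor ρ P x)

/-- The average `E_{x,y} ‖ψ̃(xy) - ψ̃(x) ψ̃(y)‖_F²` over independent uniform `x, y ∈ G`. -/
def defect [Fintype G] [FiniteDimensional ℂ V] (ρ : G →* unitary (V →L[ℂ] V))
    (P : V →L[ℂ] V) : ℝ :=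
  (∑ x : G, ∑ y : G,
    frobSq (polarMinor ρ P (x * y) - polarMinor ρ P x * polarMinor ρ P y)) /
      (Fintype.card G : ℝ) ^ 2

end Representations

/-- The quantity `4 (1 - √r) + 6 (1 - r)`, as a function of the ratio `r = d_ψ / d_ρ`. -/
def polarFactor (r : ℝ) : ℝ := 4 * (1 - √r) + 6 * (1 - r)

end ApproxRep

end

open MeasureTheory Module

set_option linter.unusedSectionVars false

noncomputable section

/-! The bound holds for every projection with invertible minors; randomness is needed only for
invertibility. Put `t = √(d/dim V)`. Over pairs `(x, y)`, with the summed Hilbert–Schmidt inner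
product, consider the chain `ψ̃(xy)`, `ψ(xy)`, `ψ(x)ψ(y)`, `ψ̃(x)ψ(y)`, `ψ̃(x)ψ̃(y)`. Schur's lemma
makes `ψ` a tight frame on both sides, so all five families have the same length. It also makes the
middle cosine exactly `t`. The other three are at least `t`, because `ψ̃†ψ = |ψ| ≥ t ψ†ψ` when `‖ψ‖
≤ 1/t` (`smul_star_mul_self_le`). Doubling the angle twice (`chain_sub_le`) gives `defect_le`.

Invertibility almost surely (`ae_isUnit_minor_conjBy`) is a genericity argument: a determinant that
is polynomial along real lines and nonzero somewhere vanishes only on a null set. Fubini moves this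
from tuples of vectors to unitaries, and Haar invariance adapts it to the given projection. For
integrability, all minors are carried to one fixed range, where the defect is continuous on the set
of unitaries with invertible minors. -/

namespace ApproxRep

/-! ### Trace and the real Hilbert–Schmidt inner product. -/

section Frobenius

variable {W : Type*} [NormedAddCommGroup W] [InnerProductSpace ℂ W] [FiniteDimensional ℂ W]
  [CompleteSpace W]

/-- The trace of a continuous linear operator, as a linear map. -/
def opTrace (W : Type*) [NormedAddCommGroup W] [InnerProductSpace ℂ W] :
    (W →L[ℂ] W) →ₗ[ℂ] ℂ :=
  (LinearMap.trace ℂ W).comp (ContinuousLinearMap.coeLM ℂ)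

theorem opTrace_apply (A : W →L[ℂ] W) : opTrace W A = LinearMap.trace ℂ W A.toLinearMap := rfl

theorem opTrace_mul_comm (A B : W →L[ℂ] W) : opTrace W (A * B) = opTrace W (B * A) :=
  LinearMap.trace_mul_comm ℂ A.toLinearMap B.toLinearMap

theorem opTrace_one : opTrace W 1 = finrank ℂ W := LinearMap.trace_one ℂ W

theorem opTrace_star (A : W →L[ℂ] W) : opTrace W (star A) = star (opTrace W A) := by
  rw [opTrace_apply, opTrace_apply, LinearMap.trace_eq_sum_inner _ (stdOrthonormalBasis ℂ W),
    LinearMap.trace_eq_sum_inner _ (stdOrthonormalBasis ℂ W), star_sum]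
  refine Finset.sum_congr rfl fun i _ => ?_
  rw [ContinuousLinearMap.coe_coe, ContinuousLinearMap.coe_coe,
    ContinuousLinearMap.star_eq_adjoint, ContinuousLinearMap.adjoint_inner_right]
  exact (inner_conj_symm _ _).symm

theorem re_opTrace_nonneg {A : W →L[ℂ] W} (hA : 0 ≤ A) : 0 ≤ (opTrace W A).re := by
  rw [ContinuousLinearMap.nonneg_iff_isPositive] at hA
  exact (Complex.le_def.mp hA.toLinearMap.trace_nonneg).1

theorem re_opTrace_mono {A B : W →L[ℂ] W} (h : A ≤ B) : (opTrace W A).re ≤ (opTrace W B).re := by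
  have := re_opTrace_nonneg (sub_nonneg.mpr h)
  rw [map_sub, Complex.sub_re] at this
  linarith

/-- The real Hilbert-Schmidt inner product `Re tr (A† B)`. -/
def frobInner (A B : W →L[ℂ] W) : ℝ := (opTrace W (star A * B)).re

theorem frobInner_comm (A B : W →L[ℂ] W) : frobInner A B = frobInner B A := by
  rw [frobInner, frobInner, show star A * B = star (star B * A) by simp, opTrace_star]
  exact Complex.conj_re _

theorem frobSq_nonneg (A : W →L[ℂ] W) : 0 ≤ frobSq A :=
  re_opTrace_nonneg (star_mul_self_nonneg A)

/-- The real inner product of two families of operators. -/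
def sumFrobInner {ι : Type*} [Fintype ι] :
    (ι → (W →L[ℂ] W)) →ₗ[ℝ] (ι → (W →L[ℂ] W)) →ₗ[ℝ] ℝ :=
  LinearMap.mk₂ ℝ (fun X Y => ∑ i, frobInner (X i) (Y i))
    (fun X X' Y => by simp [frobInner, add_mul, Finset.sum_add_distrib])
    (fun c X Y => by simp [frobInner, Finset.mul_sum])
    (fun X Y Y' => by simp [frobInner, mul_add, Finset.sum_add_distrib])
    (fun c X Y => by simp [frobInner, Finset.mul_sum])

theorem sumFrobInner_apply {ι : Type*} [Fintype ι] (X Y : ι → (W →L[ℂ] W)) :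
    sumFrobInner X Y = ∑ i, frobInner (X i) (Y i) := rfl

theorem sumFrobInner_comm {ι : Type*} [Fintype ι] (X Y : ι → (W →L[ℂ] W)) :
    sumFrobInner X Y = sumFrobInner Y X :=
  Finset.sum_congr rfl fun _ _ => frobInner_comm _ _

theorem sumFrobInner_self_nonneg {ι : Type*} [Fintype ι] (X : ι → (W →L[ℂ] W)) :
    0 ≤ sumFrobInner X X :=
  Finset.sum_nonneg fun i _ => frobSq_nonneg (X i)

end Frobenius

/-- If two vectors of a semi-inner product space make an angle of cosine at least `s ≥ 0` with a
third one, then the angle between them has cosine at least `2 s² - 1`. -/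
theorem two_mul_sq_sub_one_le {E : Type*} [AddCommGroup E] [Module ℝ E] (B : E →ₗ[ℝ] E →ₗ[ℝ] ℝ)
    (hsymm : ∀ a b, B a b = B b a) (hpos : ∀ a, 0 ≤ B a a) {a b c : E} {n s : ℝ} (hs : 0 ≤ s)
    (ha : B a a = n) (hb : B b b = n) (hc : B c c = n)
    (hab : s * n ≤ B a b) (hbc : s * n ≤ B b c) : (2 * s ^ 2 - 1) * n ≤ B a c := by
  -- In the extremal planar configuration `b` bisects the angle and `a + c = 2s b`, so positivity of
  -- this vector is sharp.
  have h := hpos (a + c - (2 * s) • b)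
  simp only [map_add, map_sub, map_smul, LinearMap.add_apply, LinearMap.sub_apply,
    LinearMap.smul_apply, smul_eq_mul, ha, hb, hc] at h
  rw [hsymm c a, hsymm b a, hsymm c b] at h
  nlinarith [mul_le_mul_of_nonneg_left hab hs, mul_le_mul_of_nonneg_left hbc hs]

/-! ### The unitary part of an invertible operator. -/

section Polar

variable {W : Type*} [NormedAddCommGroup W] [InnerProductSpace ℂ W] [CompleteSpace W]

theorem isStrictlyPositive_star_mul_self {A : W →L[ℂ] W} (hA : IsUnit A) :
    IsStrictlyPositive (star A * A) := by
  rw [IsStrictlyPositive.iff_of_unital]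
  exact ⟨star_mul_self_nonneg A, hA.star.mul hA⟩

theorem star_polarUnitary_mul {A : W →L[ℂ] W} (hA : IsUnit A) :
    star (polarUnitary A) * A = (star A * A) ^ (1 / 2 : ℝ) := by
  have hpos := isStrictlyPositive_star_mul_self hA
  have hsa : star ((star A * A) ^ (-(1 / 2) : ℝ)) = (star A * A) ^ (-(1 / 2) : ℝ) :=
    (IsSelfAdjoint.of_nonneg CFC.rpow_nonneg).star_eq
  rw [polarUnitary, star_mul, hsa, mul_assoc]
  nth_rewrite 2 [← CFC.rpow_one (star A * A) hpos.nonneg]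
  rw [← CFC.rpow_add hpos.isUnit]
  norm_num

theorem polarUnitary_mem_unitary {A : W →L[ℂ] W} (hA : IsUnit A) :
    polarUnitary A ∈ unitary (W →L[ℂ] W) := by
  have hpos := isStrictlyPositive_star_mul_self hA
  have h1 : star (polarUnitary A) * polarUnitary A = 1 := by
    rw [polarUnitary, ← mul_assoc, ← polarUnitary, star_polarUnitary_mul hA,
      CFC.rpow_mul_rpow_neg]
  have hu : IsUnit (polarUnitary A) := hA.mul (hpos.isUnit.cfcRpow _ hpos.nonneg)
  refine ⟨h1, ?_⟩
  exact hu.mul_right_cancel (by rw [mul_assoc, h1, mul_one, one_mul])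

/-- By the functional calculus of `A†A` this is the scalar inequality `t x ≤ √x`, true since `√x ≤
‖A‖ ≤ 1/t` on the spectrum. -/
theorem smul_star_mul_self_le {A : W →L[ℂ] W} (hA : IsUnit A) {t : ℝ} (ht : 0 < t)
    (hnorm : t * ‖A‖ ≤ 1) : t • (star A * A) ≤ star (polarUnitary A) * A := by
  have hpos := isStrictlyPositive_star_mul_self hA
  have h0 := hpos.nonneg
  have h1 : t • (star A * A) = cfc (fun x : ℝ => t * x) (star A * A) := by
    rw [cfc_const_mul_id (R := ℝ) t (star A * A)]
  rw [star_polarUnitary_mul hA, CFC.rpow_eq_cfc_real h0, h1]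
  refine cfc_mono (fun x hx => ?_) ?_ ?_
  · have hx0 : 0 ≤ x := spectrum_nonneg_of_nonneg h0 hx
    have hx1 : x ≤ ‖A‖ ^ 2 := by
      have := (spectrum.norm_le_norm_mul_of_mem hx).trans
        (mul_le_of_le_one_right (norm_nonneg _) ContinuousLinearMap.norm_id_le)
      rwa [CStarRing.norm_star_mul_self, Real.norm_of_nonneg hx0, ← sq] at this
    rw [← Real.sqrt_eq_rpow]
    have hs : √x ≤ ‖A‖ := Real.sqrt_le_iff.mpr ⟨norm_nonneg _, hx1⟩
    have : t * √x ≤ 1 := (mul_le_mul_of_nonneg_left hs ht.le).trans hnorm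
    nlinarith [Real.mul_self_sqrt hx0, Real.sqrt_nonneg x]
  · fun_prop
  · exact ContinuousOn.rpow_const continuousOn_id fun x _ => Or.inr (by norm_num)

end Polar

/-! ### The chain estimate and its application to operator families. -/

/-- A chain of five vectors of equal length, consecutive ones at an angle of cosine at least `t`:
the squared distance of the end points is bounded through the quadruple angle formula. -/
theorem chain_sub_le {E : Type*} [AddCommGroup E] [Module ℝ E] (S : E →ₗ[ℝ] E →ₗ[ℝ] ℝ)
    (hsymm : ∀ a b, S a b = S b a) (hpos : ∀ a, 0 ≤ S a a) {a b c d e : E} {n t : ℝ}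
    (ht : 0 ≤ t) (ht1 : t ≤ 1) (ha : S a a = n) (hb : S b b = n) (hc : S c c = n)
    (hd : S d d = n) (he : S e e = n) (hab : t * n ≤ S a b) (hbc : t * n ≤ S b c)
    (hcd : t * n ≤ S c d) (hde : t * n ≤ S d e) :
    S (a - e) (a - e) ≤ 2 * n * polarFactor (t ^ 2) := by
  have hn : 0 ≤ n := ha ▸ hpos a
  have hexp : S (a - e) (a - e) = 2 * n - 2 * S a e := by
    simp only [map_sub, LinearMap.sub_apply, ha, he, hsymm e a]
    ring
  rw [hexp, polarFactor, Real.sqrt_sq ht,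
    show 2 * n * (4 * (1 - t) + 6 * (1 - t ^ 2)) =
      n * (2 * (4 * (1 - t) + 6 * (1 - t ^ 2))) by ring]
  have hac := two_mul_sq_sub_one_le S hsymm hpos ht ha hb hc hab hbc
  have hce := two_mul_sq_sub_one_le S hsymm hpos ht hc hd he hcd hde
  rcases le_total 0 (2 * t ^ 2 - 1) with hs | hs
  -- The second doubling needs a nonnegative cosine, whence the case split. In `key`, right side
  -- minus left side is `(1 - t)² (16t² + 32t + 20)`.
  · have hae := two_mul_sq_sub_one_le S hsymm hpos hs ha hc he hac hce
    have key : 2 - 2 * (2 * (2 * t ^ 2 - 1) ^ 2 - 1) ≤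
        2 * (4 * (1 - t) + 6 * (1 - t ^ 2)) := by
      nlinarith [mul_nonneg (mul_nonneg (sub_nonneg.mpr ht1) (sub_nonneg.mpr ht1))
        (show 0 ≤ 16 * t ^ 2 + 32 * t + 20 by positivity)]
    nlinarith [mul_le_mul_of_nonneg_left key hn]
  -- Here `t² ≤ 1/2`, and the trivial bound `4n` on the squared distance is already below the claim.
  · have hae : -n ≤ S a e := by
      have h := hpos (a + e)
      simp only [map_add, LinearMap.add_apply, ha, he, hsymm e a] at h
      linarith
    have ht2 : t ≤ 3 / 4 := by nlinarith
    have key : (4 : ℝ) ≤ 2 * (4 * (1 - t) + 6 * (1 - t ^ 2)) := by nlinarith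
    nlinarith [mul_le_mul_of_nonneg_left key hn]

/-- An upper bound for the squared defect of the unitary parts `u` of a family `ψ` of operators
that is a tight frame on both sides and multiplicative up to a factor `t` on average. -/
theorem sum_frobSq_sub_le {G : Type*} [Group G] [Fintype G]
    {W : Type*} [NormedAddCommGroup W] [InnerProductSpace ℂ W] [FiniteDimensional ℂ W]
    [CompleteSpace W] (ψ u : G → (W →L[ℂ] W)) {t : ℝ} (ht : 0 ≤ t) (ht1 : t ≤ 1)
    (hleft : ∑ x, star (ψ x) * ψ x = (Fintype.card G : ℂ) • 1)
    (hright : ∑ x, ψ x * star (ψ x) = (Fintype.card G : ℂ) • 1)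
    (hu : ∀ x, u x ∈ unitary (W →L[ℂ] W))
    (habs : ∀ x, t • (star (ψ x) * ψ x) ≤ star (u x) * ψ x)
    (hmul : ∑ x, ∑ y, star (ψ (x * y)) * (ψ x * ψ y) = (t * (Fintype.card G : ℂ) ^ 2) • 1) :
    ∑ x, ∑ y, frobSq (u (x * y) - u x * u y) ≤
      (Fintype.card G : ℝ) ^ 2 * (2 * (finrank ℂ W : ℝ) * polarFactor (t ^ 2)) := by
  set N : ℝ := (Fintype.card G : ℝ) with hN
  set d : ℝ := (finrank ℂ W : ℝ) with hd
  have hNC : (Fintype.card G : ℂ) = (N : ℂ) := by simp [hN]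
  have htr1 : opTrace W 1 = (d : ℂ) := by simp [hd, opTrace_one]
  have hd0 : 0 ≤ d := by positivity
  have huu : ∀ x, star (u x) * u x = 1 := fun x => (hu x).1
  have hunit : ∀ v ∈ unitary (W →L[ℂ] W), frobInner v v = d := fun v hv => by
    rw [frobInner, hv.1, htr1, Complex.ofReal_re]
  have hψψ : ∑ x, frobInner (ψ x) (ψ x) = N * d := by
    simp only [frobInner, ← Complex.re_sum, ← map_sum]
    rw [hleft, map_smul, htr1, hNC]
    simp
  have huψ : t * (N * d) ≤ ∑ x, frobInner (u x) (ψ x) := by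
    rw [← hψψ, Finset.mul_sum]
    refine Finset.sum_le_sum fun x _ => ?_
    have := re_opTrace_mono (habs x)
    rwa [← Complex.coe_smul, map_smul, smul_eq_mul, Complex.re_ofReal_mul] at this
  have hshift : ∀ f : G → ℝ, ∑ p : G × G, f (p.1 * p.2) = N * ∑ x, f x := fun f => by
    rw [Fintype.sum_prod_type]
    have : ∀ x : G, ∑ y, f (x * y) = ∑ y, f y := fun x => Equiv.sum_comp (Equiv.mulLeft x) f
    simp [this, hN]
  let A : G × G → (W →L[ℂ] W) := fun p => u (p.1 * p.2)
  let B : G × G → (W →L[ℂ] W) := fun p => ψ (p.1 * p.2)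
  let C : G × G → (W →L[ℂ] W) := fun p => ψ p.1 * ψ p.2
  let D : G × G → (W →L[ℂ] W) := fun p => u p.1 * ψ p.2
  let E : G × G → (W →L[ℂ] W) := fun p => u p.1 * u p.2
  have hsum2 : ∑ _p : G × G, d = N ^ 2 * d := by simp [hN, sq]
  have hAA : sumFrobInner A A = N ^ 2 * d := by
    rw [sumFrobInner_apply, ← hsum2]
    exact Finset.sum_congr rfl fun p _ => hunit _ (hu _)
  have hEE : sumFrobInner E E = N ^ 2 * d := by
    rw [sumFrobInner_apply, ← hsum2]
    exact Finset.sum_congr rfl fun p _ => hunit _ (mul_mem (hu _) (hu _))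
  have hBB : sumFrobInner B B = N ^ 2 * d := by
    rw [sumFrobInner_apply, hshift fun x => frobInner (ψ x) (ψ x), hψψ]
    ring
  have hAB : t * (N ^ 2 * d) ≤ sumFrobInner A B := by
    rw [sumFrobInner_apply, hshift fun x => frobInner (u x) (ψ x)]
    have hN0 : 0 ≤ N := by positivity
    linarith [mul_le_mul_of_nonneg_left huψ hN0]
  -- Cyclicity of the trace brings `ψ(y)ψ(y)†` together, and the right frame identity sums it away
  -- over `y`. Taking `X = ψ` gives the length of `C`, and `X = u` its angle with `D`.
  have hXC : ∀ X : G → (W →L[ℂ] W), ∑ p : G × G, frobInner (X p.1 * ψ p.2) (ψ p.1 * ψ p.2) =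
      N * ∑ x, frobInner (X x) (ψ x) := fun X => by
    rw [Fintype.sum_prod_type, Finset.mul_sum]
    refine Finset.sum_congr rfl fun x _ => ?_
    simp only [frobInner]
    have : ∀ y, opTrace W (star (X x * ψ y) * (ψ x * ψ y)) =
        opTrace W (star (X x) * ψ x * (ψ y * star (ψ y))) := fun y => by
      rw [star_mul, mul_assoc, opTrace_mul_comm]
      simp only [mul_assoc]
    simp only [this, ← Complex.re_sum, ← map_sum, ← Finset.mul_sum]
    rw [hright, hNC, mul_smul_comm, mul_one, map_smul, smul_eq_mul, Complex.re_ofReal_mul]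
  have hCC : sumFrobInner C C = N ^ 2 * d := by
    rw [sumFrobInner_apply, hXC ψ, hψψ]
    ring
  have hDC : t * (N ^ 2 * d) ≤ sumFrobInner C D := by
    rw [sumFrobInner_comm, sumFrobInner_apply, hXC u]
    have hN0 : 0 ≤ N := by positivity
    linarith [mul_le_mul_of_nonneg_left huψ hN0]
  have hBC : sumFrobInner B C = t * (N ^ 2 * d) := by
    rw [sumFrobInner_apply, Fintype.sum_prod_type]
    simp only [B, C, frobInner, ← Complex.re_sum, ← map_sum]
    rw [hmul, map_smul, htr1, hNC, smul_eq_mul, ← Complex.ofReal_pow, ← Complex.ofReal_mul,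
      ← Complex.ofReal_mul, Complex.ofReal_re]
    ring
  have huX : ∀ x (X Y : W →L[ℂ] W), frobInner (u x * X) (u x * Y) = frobInner X Y :=
    fun x X Y => by
      rw [frobInner, frobInner, star_mul, mul_assoc, ← mul_assoc (star (u x)), huu, one_mul]
  have hDD : sumFrobInner D D = N ^ 2 * d := by
    rw [sumFrobInner_apply, Fintype.sum_prod_type]
    simp only [D, huX, hψψ]
    simp [hN]
    ring
  have hDE : t * (N ^ 2 * d) ≤ sumFrobInner D E := by
    rw [sumFrobInner_comm, sumFrobInner_apply, Fintype.sum_prod_type]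
    simp only [D, E, huX]
    rw [Finset.sum_const, Finset.card_univ, nsmul_eq_mul, ← hN]
    have hN0 : 0 ≤ N := by positivity
    linarith [mul_le_mul_of_nonneg_left huψ hN0]
  have hlhs : ∑ x, ∑ y, frobSq (u (x * y) - u x * u y) = sumFrobInner (A - E) (A - E) :=
    (Fintype.sum_prod_type (f := fun p : G × G => frobSq (A p - E p))).symm
  rw [hlhs]
  refine (chain_sub_le (sumFrobInner (W := W) (ι := G × G)) sumFrobInner_comm sumFrobInner_self_nonneg ht ht1
    hAA hBB hCC hDD hEE hAB hBC.ge hDC hDE).trans_eq ?_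
  ring

theorem smul_opMul_smul {W : Type*} [NormedAddCommGroup W] [InnerProductSpace ℂ W] (a b : ℂ)
    (A B : W →L[ℂ] W) : (a • A) * (b • B) = (a * b) • (A * B) :=
  smul_mul_smul_comm a A b B

/-! ### Compression to the range of a projection. -/

section Compress

variable {V : Type*} [NormedAddCommGroup V] [InnerProductSpace ℂ V] [FiniteDimensional ℂ V]
  [CompleteSpace V]

theorem IsStarProjection.apply_apply {P : V →L[ℂ] V} (hP : IsStarProjection P) (v : V) :
    P (P v) = P v :=
  DFunLike.congr_fun hP.isIdempotentElem v

theorem IsStarProjection.apply_coe {P : V →L[ℂ] V} (hP : IsStarProjection P) (w : P.range) :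
    P w = w := by
  obtain ⟨_, v, rfl⟩ := w
  exact IsStarProjection.apply_apply hP v

theorem coe_compress_apply {P : V →L[ℂ] V} (hP : IsStarProjection P) (T : V →L[ℂ] V)
    (w : P.range) : (compress P T w : V) = P (T w) := by
  change P (T (P w)) = P (T w)
  rw [IsStarProjection.apply_coe hP]

theorem compress_add (P S T : V →L[ℂ] V) :
    compress P (S + T) = compress P S + compress P T := by
  ext w
  exact map_add P (S (P w)) (T (P w))

theorem compress_smul (P T : V →L[ℂ] V) (c : ℂ) : compress P (c • T) = c • compress P T := by
  ext w
  exact map_smul P c (T (P w))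

theorem compress_sum {ι : Type*} (s : Finset ι) (P : V →L[ℂ] V) (T : ι → (V →L[ℂ] V)) :
    compress P (∑ i ∈ s, T i) = ∑ i ∈ s, compress P (T i) := by
  let L : (V →L[ℂ] V) →ₗ[ℂ] (P.range →L[ℂ] P.range) :=
    { toFun := compress P
      map_add' := compress_add P
      map_smul' := fun c T => compress_smul P T c }
  exact map_sum L T s

theorem compress_one {P : V →L[ℂ] V} (hP : IsStarProjection P) : compress P 1 = 1 := by
  ext w
  rw [coe_compress_apply hP]
  exact IsStarProjection.apply_coe hP w

theorem compress_mul {P : V →L[ℂ] V} (hP : IsStarProjection P) (S T : V →L[ℂ] V) :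
    compress P S * compress P T = compress P (S * P * T) := by
  ext w
  rw [mul_apply_eq_comp, coe_compress_apply hP, coe_compress_apply hP,
    coe_compress_apply hP]
  rfl

theorem inner_apply_of_isStarProjection {P : V →L[ℂ] V} (hP : IsStarProjection P) (v w : V) :
    inner ℂ (P v) w = inner ℂ v (P w) := by
  have h : ContinuousLinearMap.adjoint P = P := hP.isSelfAdjoint
  nth_rewrite 1 [← h]
  rw [ContinuousLinearMap.adjoint_inner_left]

theorem star_compress {P : V →L[ℂ] V} (hP : IsStarProjection P) (T : V →L[ℂ] V) :
    star (compress P T) = compress P (star T) := by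
  rw [ContinuousLinearMap.star_eq_adjoint, eq_comm, ContinuousLinearMap.eq_adjoint_iff]
  intro v w
  rw [Submodule.coe_inner, Submodule.coe_inner, coe_compress_apply hP, coe_compress_apply hP,
    inner_apply_of_isStarProjection hP, IsStarProjection.apply_coe hP,
    ← inner_apply_of_isStarProjection hP, IsStarProjection.apply_coe hP,
    ContinuousLinearMap.star_eq_adjoint, ContinuousLinearMap.adjoint_inner_left]

theorem opTrace_of_isProjectionOfRank {P : V →L[ℂ] V} {d : ℕ} (hP : IsProjectionOfRank P d) :
    opTrace V P = d := by
  have h : LinearMap.IsProj P.range P.toLinearMap :=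
    ⟨fun v => ⟨v, rfl⟩, fun v hv => IsStarProjection.apply_coe hP.1 ⟨v, hv⟩⟩
  rw [opTrace_apply, h.trace, hP.2]

theorem norm_compress_le {P : V →L[ℂ] V} (hP : IsStarProjection P) (T : V →L[ℂ] V) :
    ‖compress P T‖ ≤ ‖T‖ := by
  refine ContinuousLinearMap.opNorm_le_bound _ (norm_nonneg _) fun w => ?_
  rw [Submodule.coe_norm, coe_compress_apply hP]
  exact (ContinuousLinearMap.le_of_opNorm_le _ hP.norm_le _).trans
    (by rw [one_mul]; exact T.le_opNorm w)

end Compress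

/-! ### Schur averaging and the deterministic bound. -/

section Schur

variable {G : Type*} [Group G] [Fintype G]
  {V : Type*} [NormedAddCommGroup V] [InnerProductSpace ℂ V] [FiniteDimensional ℂ V]
  [CompleteSpace V]

theorem eq_smul_one_of_commute (ρ : G →* unitary (V →L[ℂ] V))
    (hρ : (toRepresentation ρ).IsIrreducible) (T : V →L[ℂ] V)
    (hT : ∀ x, (ρ x : V →L[ℂ] V) * T = T * ρ x) : ∃ c : ℂ, T = c • 1 := by
  let f : Representation.IntertwiningMap (toRepresentation ρ) (toRepresentation ρ) :=
    { toLinearMap := T.toLinearMap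
      isIntertwining' := fun x => by
        ext v
        exact (DFunLike.congr_fun (hT x) v).symm }
  obtain ⟨c, hc⟩ := (Representation.IsIrreducible.algebraMap_intertwiningMap_bijective_of_isAlgClosed
    (ρ := toRepresentation ρ)).2 f
  refine ⟨c, ?_⟩
  ext v
  have : f v = T v := rfl
  rw [← this, ← hc]
  rfl

/-- The average commutes with `ρ`, hence is scalar by Schur's lemma; comparing traces identifies the
scalar. -/
theorem sum_star_mul_mul (ρ : G →* unitary (V →L[ℂ] V))
    (hρ : (toRepresentation ρ).IsIrreducible) (A : V →L[ℂ] V) :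
    ∑ x, star (ρ x : V →L[ℂ] V) * A * ρ x =
      ((Fintype.card G : ℂ) * (opTrace V A / finrank ℂ V)) • 1 := by
  have hcomm : ∀ x, (ρ x : V →L[ℂ] V) * (∑ x, star (ρ x : V →L[ℂ] V) * A * ρ x) =
      (∑ x, star (ρ x : V →L[ℂ] V) * A * ρ x) * ρ x := fun x => by
    rw [Finset.mul_sum, Finset.sum_mul, ← Equiv.sum_comp (Equiv.mulRight x)]
    refine Finset.sum_congr rfl fun y _ => ?_
    have h1 : (ρ x : V →L[ℂ] V) * star (ρ x : V →L[ℂ] V) = 1 := (ρ x).2.2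
    simp only [Equiv.coe_mulRight, map_mul, Submonoid.coe_mul, star_mul]
    simp only [← mul_assoc, h1, one_mul]
  obtain ⟨c, hc⟩ := eq_smul_one_of_commute ρ hρ _ hcomm
  have htr := congrArg (opTrace V) hc
  have hx : ∀ x, opTrace V (star (ρ x : V →L[ℂ] V) * A * ρ x) = opTrace V A := fun x => by
    have h1 : (ρ x : V →L[ℂ] V) * star (ρ x : V →L[ℂ] V) = 1 := (ρ x).2.2
    rw [opTrace_mul_comm, ← mul_assoc, h1, one_mul]
  simp only [map_sum, hx, map_smul, opTrace_one, Finset.sum_const, Finset.card_univ,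
    nsmul_eq_mul, smul_eq_mul] at htr
  rw [hc]
  rcases Nat.eq_zero_or_pos (finrank ℂ V) with h0 | h0
  · have : Subsingleton V := finrank_zero_iff.mp h0
    ext v
    exact Subsingleton.elim _ _
  · have h0' : (finrank ℂ V : ℂ) ≠ 0 := Nat.cast_ne_zero.mpr h0.ne'
    congr 1
    field_simp
    rw [htr]

theorem minor_eq (ρ : G →* unitary (V →L[ℂ] V)) {P : V →L[ℂ] V} {d : ℕ}
    (hP : IsProjectionOfRank P d) (x : G) :
    minor ρ P x = ((√((finrank ℂ V : ℝ) / d) : ℝ) : ℂ) • compress P (ρ x : V →L[ℂ] V) := by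
  rw [minor, hP.2]

theorem star_minor (ρ : G →* unitary (V →L[ℂ] V)) {P : V →L[ℂ] V} {d : ℕ}
    (hP : IsProjectionOfRank P d) (x : G) : star (minor ρ P x) = minor ρ P x⁻¹ := by
  rw [minor_eq ρ hP, minor_eq ρ hP, star_smul, star_compress hP.1, map_inv]
  congr 1
  exact Complex.conj_ofReal _

theorem sum_star_minor_mul_minor (ρ : G →* unitary (V →L[ℂ] V))
    (hρ : (toRepresentation ρ).IsIrreducible) {P : V →L[ℂ] V} {d : ℕ} (hd : 0 < d)
    (hdV : d ≤ finrank ℂ V) (hP : IsProjectionOfRank P d) :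
    ∑ x, star (minor ρ P x) * minor ρ P x = (Fintype.card G : ℂ) • 1 := by
  have hd' : (d : ℝ) ≠ 0 := by positivity
  have hD' : (finrank ℂ V : ℝ) ≠ 0 := by exact_mod_cast (hd.trans_le hdV).ne'
  have hterm : ∀ x, star (minor ρ P x) * minor ρ P x =
      (((finrank ℂ V : ℝ) / d : ℝ) : ℂ) • compress P (star (ρ x : V →L[ℂ] V) * P * ρ x) :=
    fun x => by
      rw [minor_eq ρ hP, star_smul, star_compress hP.1, smul_opMul_smul, compress_mul hP.1]
      congr 1
      rw [Complex.star_def, Complex.conj_ofReal, ← Complex.ofReal_mul,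
        Real.mul_self_sqrt (by positivity)]
  simp only [hterm, ← Finset.smul_sum, ← compress_sum]
  rw [sum_star_mul_mul ρ hρ, compress_smul, compress_one hP.1, smul_smul,
    opTrace_of_isProjectionOfRank hP]
  congr 1
  push_cast
  have : (d : ℂ) ≠ 0 := by exact_mod_cast hd'
  have : (finrank ℂ V : ℂ) ≠ 0 := by exact_mod_cast hD'
  field_simp

/-- Summing over `x` averages one copy of `P`, then summing over `y` averages the other. Each gives
a factor `d/dim V = k⁻²`, against `k³` from the scaling of the three minors; what remains is `k⁻¹`.
-/
theorem sum_star_minor_mul_minor_mul_minor (ρ : G →* unitary (V →L[ℂ] V))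
    (hρ : (toRepresentation ρ).IsIrreducible) {P : V →L[ℂ] V} {d : ℕ} (hd : 0 < d)
    (hdV : d ≤ finrank ℂ V) (hP : IsProjectionOfRank P d) :
    ∑ x, ∑ y, star (minor ρ P (x * y)) * (minor ρ P x * minor ρ P y) =
      (((√((d : ℝ) / finrank ℂ V) : ℝ) : ℂ) * (Fintype.card G : ℂ) ^ 2) • 1 := by
  have hd' : (0 : ℝ) < d := by positivity
  have hD' : (0 : ℝ) < finrank ℂ V := by exact_mod_cast (hd.trans_le hdV)
  set k : ℝ := √((finrank ℂ V : ℝ) / d) with hk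
  have hterm : ∀ x y, star (minor ρ P (x * y)) * (minor ρ P x * minor ρ P y) =
      ((k ^ 3 : ℝ) : ℂ) • compress P (star (ρ y : V →L[ℂ] V) *
        (star (ρ x : V →L[ℂ] V) * P * ρ x) * (P * ρ y)) :=
    fun x y => by
      simp only [minor_eq ρ hP, ← hk]
      rw [star_smul, star_compress hP.1, smul_opMul_smul, smul_opMul_smul,
        compress_mul hP.1, compress_mul hP.1]
      congr 1
      · rw [Complex.star_def, Complex.conj_ofReal]
        push_cast
        ring
      · simp only [map_mul, Submonoid.coe_mul, star_mul, mul_assoc]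
  simp only [hterm, ← Finset.smul_sum, ← compress_sum]
  rw [Finset.sum_comm]
  simp only [← Finset.mul_sum, ← Finset.sum_mul]
  rw [sum_star_mul_mul ρ hρ]
  simp only [mul_smul_comm, smul_mul_assoc, mul_one, ← Finset.smul_sum, ← mul_assoc]
  rw [sum_star_mul_mul ρ hρ, compress_smul, compress_smul, compress_one hP.1, smul_smul,
    smul_smul, opTrace_of_isProjectionOfRank hP]
  congr 1
  have hinv : √((d : ℝ) / finrank ℂ V) = k⁻¹ := by
    rw [hk, ← Real.sqrt_inv, inv_div]
  have hk0 : k ≠ 0 := (Real.sqrt_pos.mpr (by positivity)).ne'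
  have hr : (d : ℝ) / finrank ℂ V = (k ^ 2)⁻¹ := by
    rw [hk, Real.sq_sqrt (by positivity), inv_div]
  have hrC : (d : ℂ) / finrank ℂ V = ((k : ℂ) ^ 2)⁻¹ := by
    rw [← Complex.ofReal_pow, ← Complex.ofReal_inv, ← hr]
    simp
  have hkC : (k : ℂ) ≠ 0 := by exact_mod_cast hk0
  rw [hinv, hrC]
  push_cast
  field_simp

theorem defect_nonneg (ρ : G →* unitary (V →L[ℂ] V)) (P : V →L[ℂ] V) : 0 ≤ defect ρ P :=
  div_nonneg (Finset.sum_nonneg fun _ _ => Finset.sum_nonneg fun _ _ => frobSq_nonneg _)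
    (by positivity)

theorem polarMinor_mem_unitary (ρ : G →* unitary (V →L[ℂ] V)) {P : V →L[ℂ] V} {x : G}
    (h : IsUnit (minor ρ P x)) : polarMinor ρ P x ∈ unitary (P.range →L[ℂ] P.range) :=
  polarUnitary_mem_unitary h

/-- The bound on the defect holds for every projection with invertible minors. -/
theorem defect_le (ρ : G →* unitary (V →L[ℂ] V))
    (hρ : (toRepresentation ρ).IsIrreducible) {P : V →L[ℂ] V} {d : ℕ} (hd : 0 < d)
    (hdV : d ≤ finrank ℂ V) (hP : IsProjectionOfRank P d)
    (hunit : ∀ x, IsUnit (minor ρ P x)) :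
    defect ρ P ≤ 2 * (d : ℝ) * polarFactor ((d : ℝ) / finrank ℂ V) := by
  have hd' : (0 : ℝ) < d := by positivity
  have hD' : (0 : ℝ) < finrank ℂ V := by exact_mod_cast (hd.trans_le hdV)
  set t : ℝ := √((d : ℝ) / finrank ℂ V) with ht
  have ht0 : 0 < t := Real.sqrt_pos.mpr (by positivity)
  have ht1 : t ≤ 1 := Real.sqrt_le_one.mpr ((div_le_one hD').mpr (by exact_mod_cast hdV))
  have hleft := sum_star_minor_mul_minor ρ hρ hd hdV hP
  -- Since `ψ(x)† = ψ(x⁻¹)`, inversion on `G` exchanges the two frame identities.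
  have hright : ∑ x, minor ρ P x * star (minor ρ P x) = (Fintype.card G : ℂ) • 1 := by
    rw [← hleft, ← Equiv.sum_comp (Equiv.inv G)]
    refine Finset.sum_congr rfl fun x _ => ?_
    simp only [Equiv.inv_apply, star_minor ρ hP, inv_inv]
  have habs : ∀ x, t • (star (minor ρ P x) * minor ρ P x) ≤
      star (polarMinor ρ P x) * minor ρ P x := fun x => by
    refine smul_star_mul_self_le (hunit x) ht0 ?_
    have hnt : Nontrivial V := finrank_pos_iff.mp (hd.trans_le hdV)
    have h1 : ‖compress P (ρ x : V →L[ℂ] V)‖ ≤ 1 :=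
      (norm_compress_le hP.1 _).trans (CStarRing.norm_coe_unitary (ρ x)).le
    have hinv : t * √((finrank ℂ V : ℝ) / d) = 1 := by
      rw [ht, ← Real.sqrt_mul (by positivity), div_mul_div_cancel₀ hD'.ne', div_self hd'.ne',
        Real.sqrt_one]
    rw [minor_eq ρ hP, norm_smul, Complex.norm_real, Real.norm_of_nonneg (Real.sqrt_nonneg _),
      ← mul_assoc, hinv, one_mul]
    exact h1
  have key := sum_frobSq_sub_le (minor ρ P) (polarMinor ρ P) ht0.le ht1 hleft hright
    (fun x => polarMinor_mem_unitary ρ (hunit x)) habs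
    (sum_star_minor_mul_minor_mul_minor ρ hρ hd hdV hP)
  rw [hP.2, ht, Real.sq_sqrt (by positivity)] at key
  have hN : (0 : ℝ) < (Fintype.card G : ℝ) ^ 2 := by
    have := Fintype.card_pos (α := G)
    positivity
  rw [defect, div_le_iff₀ hN]
  linarith

end Schur

/-! ### Null zero sets and invariant subspaces. -/

/-- A function on a finite-dimensional real space that is polynomial along lines and not
identically zero vanishes only on a null set. -/
theorem ae_ne_zero_of_polynomial_on_lines {E : Type*} [NormedAddCommGroup E] [NormedSpace ℝ E]
    [FiniteDimensional ℝ E] [MeasurableSpace E] [BorelSpace E] (μ : Measure E)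
    [μ.IsAddHaarMeasure] {f : E → ℂ} (hf : Continuous f)
    (hpoly : ∀ v w : E, ∃ p : Polynomial ℂ, ∀ s : ℝ, f (v + s • w) = p.eval (s : ℂ))
    {v₀ : E} (hv₀ : f v₀ ≠ 0) : ∀ᵐ v ∂μ, f v ≠ 0 := by
  have hfin : ∀ v, ∀ᵐ s : ℝ, f (v₀ + s • (v - v₀)) ≠ 0 := fun v => by
    obtain ⟨p, hp⟩ := hpoly v₀ (v - v₀)
    have hp0 : p ≠ 0 := by
      rintro rfl
      have := hp 0
      simp [hv₀] at this
    have hroots : {s : ℝ | p.IsRoot (s : ℂ)}.Finite :=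
      (Polynomial.finite_setOfPred_isRoot hp0).preimage Complex.ofReal_injective.injOn
    refine (measure_mono_null (fun s hs => ?_) (hroots.measure_zero volume))
    simpa [hp s] using hs
  have hmeas : MeasurableSet {q : E × ℝ | f (v₀ + q.2 • (q.1 - v₀)) ≠ 0} := by
    have : Continuous fun q : E × ℝ => f (v₀ + q.2 • (q.1 - v₀)) := by fun_prop
    exact (isOpen_ne_fun this continuous_const).measurableSet
  -- Each line through `v₀` has finitely many zeros, so by Fubini some `s ≠ 0` works for almost
  -- every `v`. The homothety of ratio `s` about `v₀` then carries the null exceptional set onto the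
  -- zero set of `f`.
  have hswap := (Measure.ae_ae_comm (μ := μ) (ν := (volume : Measure ℝ))
    (p := fun v s => f (v₀ + s • (v - v₀)) ≠ 0) hmeas).mp (Filter.Eventually.of_forall hfin)
  obtain ⟨s, hs, hs0⟩ := (hswap.and (Measure.ae_ne volume (0 : ℝ))).exists
  have himage : AffineMap.homothety v₀ s '' {v | ¬ f (v₀ + s • (v - v₀)) ≠ 0} =
      {v | ¬ f v ≠ 0} := by
    ext v
    constructor
    · rintro ⟨w, hw, rfl⟩
      simpa [AffineMap.homothety_apply, add_comm] using hw
    · intro hv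
      refine ⟨v₀ + s⁻¹ • (v - v₀), ?_, ?_⟩
      · simpa [smul_smul, hs0] using hv
      · simp [AffineMap.homothety_apply, smul_smul, hs0]
  rw [ae_iff, ← himage, Measure.addHaar_image_homothety, ae_iff.mp hs, mul_zero]

/-- Triangularization: an eigenvector of the induced map on `V ⧸ W` lifts to a vector that enlarges
`W` by one dimension. -/
theorem exists_invariant_submodule {V : Type*} [AddCommGroup V] [Module ℂ V]
    [FiniteDimensional ℂ V] (T : End ℂ V) {k : ℕ} (hk : k ≤ finrank ℂ V) :
    ∃ W : Submodule ℂ V, finrank ℂ W = k ∧ W ≤ W.comap T := by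
  induction k with
  | zero => exact ⟨⊥, finrank_bot ℂ V, bot_le⟩
  | succ k ih =>
    obtain ⟨W, hW, hTW⟩ := ih (by omega)
    have hquot : 0 < finrank ℂ (V ⧸ W) := by
      have := W.finrank_quotient_add_finrank
      omega
    have : Nontrivial (V ⧸ W) := finrank_pos_iff.mp hquot
    obtain ⟨c, hc⟩ := Module.End.exists_eigenvalue (W.mapQ W T hTW)
    obtain ⟨q, hq⟩ := hc.exists_hasEigenvector
    obtain ⟨v, rfl⟩ := W.mkQ_surjective q
    have hv : v ∉ W := fun h => hq.2 ((Submodule.Quotient.mk_eq_zero W).mpr h)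
    have hTv : T v - c • v ∈ W := by
      have := hq.apply_eq_smul
      rw [Submodule.mkQ_apply, Submodule.mapQ_apply, ← Submodule.Quotient.mk_smul,
        Submodule.Quotient.eq] at this
      exact this
    refine ⟨W ⊔ Submodule.span ℂ {v}, ?_, ?_⟩
    · rw [Submodule.finrank_sup_span_singleton hv, hW]
    · refine sup_le (hTW.trans (Submodule.comap_mono le_sup_left)) ?_
      rw [Submodule.span_singleton_le_iff_mem, Submodule.mem_comap]
      have : T v = (T v - c • v) + c • v := by abel
      rw [this]
      exact add_mem (Submodule.mem_sup_left hTv)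
        (Submodule.mem_sup_right (Submodule.smul_mem _ _ (Submodule.mem_span_singleton_self v)))

/-! ### Determinants that detect invertible compressions. -/

section Gram

variable {V : Type*} [NormedAddCommGroup V] [InnerProductSpace ℂ V]

/-- The matrix `⟨v i, T (v j)⟩`. -/
def formMatrix {d : ℕ} (T : V →L[ℂ] V) (v : Fin d → V) : Matrix (Fin d) (Fin d) ℂ :=
  Matrix.of fun i j => inner ℂ (v i) (T (v j))

theorem formMatrix_mulVec {d : ℕ} (T : V →L[ℂ] V) (v : Fin d → V) (c : Fin d → ℂ) (i : Fin d) :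
    (formMatrix T v).mulVec c i = inner ℂ (v i) (T (∑ j, c j • v j)) := by
  simp [formMatrix, Matrix.mulVec, dotProduct, map_sum, mul_comm]

theorem linearIndependent_of_det_formMatrix_ne_zero {d : ℕ} {T : V →L[ℂ] V} {v : Fin d → V}
    (h : (formMatrix T v).det ≠ 0) : LinearIndependent ℂ v := by
  rw [Fintype.linearIndependent_iff]
  intro c hc
  have : (formMatrix T v).mulVec c = 0 := by
    ext i
    rw [formMatrix_mulVec, hc, map_zero, inner_zero_right, Pi.zero_apply]
  exact congrFun (Matrix.eq_zero_of_mulVec_eq_zero h this)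

/-- On an orthonormal basis of a `T`-invariant subspace, this is the matrix of the restriction of
`T`, which is still injective. -/
theorem exists_det_formMatrix_ne_zero [FiniteDimensional ℂ V] {d : ℕ} (hd : d ≤ finrank ℂ V)
    {T : V →L[ℂ] V} (hT : Function.Injective T) :
    ∃ v : Fin d → V, (formMatrix T v).det ≠ 0 := by
  obtain ⟨W, hW, hTW⟩ := exists_invariant_submodule T.toLinearMap hd
  let b : OrthonormalBasis (Fin d) ℂ W := (stdOrthonormalBasis ℂ W).reindex (finCongr hW)
  refine ⟨fun i => b i, fun hdet => ?_⟩
  obtain ⟨c, hc0, hc⟩ := Matrix.exists_mulVec_eq_zero_iff.mpr hdet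
  let w : W := ∑ j, c j • b j
  have hw : (w : V) = ∑ j, c j • (b j : V) := by simp [w]
  have hTw : T w ∈ W := hTW w.2
  have hzero : (⟨T w, hTw⟩ : W) = 0 := by
    refine InnerProductSpace.ext_inner_left_basis b.toBasis fun i => ?_
    have := congrFun hc i
    rw [formMatrix_mulVec, ← hw] at this
    rw [inner_zero_right, b.coe_toBasis]
    exact this
  have hw0 : w = 0 := by
    have h1 : T w = 0 := congrArg Subtype.val hzero
    exact Subtype.ext (hT (h1.trans (map_zero T).symm))
  exact hc0 (funext fun i => Fintype.linearIndependent_iff.mp b.toBasis.linearIndependent c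
    (by simpa [w] using hw0) i)

/-- The parameter must be real: the form is conjugate-linear on the left, and only for real `s` are
the entries quadratic polynomials in `s`. -/
theorem exists_polynomial_det_formMatrix {d : ℕ} (T : V →L[ℂ] V) (v w : Fin d → V) :
    ∃ p : Polynomial ℂ, ∀ s : ℝ, (formMatrix T (v + s • w)).det = p.eval (s : ℂ) := by
  let M : Matrix (Fin d) (Fin d) (Polynomial ℂ) := Matrix.of fun i j =>
    Polynomial.C (inner ℂ (v i) (T (v j))) +
      Polynomial.C (inner ℂ (v i) (T (w j)) + inner ℂ (w i) (T (v j))) * Polynomial.X +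
      Polynomial.C (inner ℂ (w i) (T (w j))) * Polynomial.X ^ 2
  refine ⟨M.det, fun s => ?_⟩
  rw [← Polynomial.coe_evalRingHom, RingHom.map_det]
  congr 1
  ext i j
  simp only [formMatrix, M, Matrix.of_apply, RingHom.mapMatrix_apply, Matrix.map_apply,
    Polynomial.coe_evalRingHom, Polynomial.eval_add, Polynomial.eval_mul, Polynomial.eval_C,
    Polynomial.eval_X, Polynomial.eval_pow, Pi.add_apply, Pi.smul_apply, ← Complex.coe_smul,
    map_add, map_smul, inner_add_left, inner_add_right, inner_smul_left, inner_smul_right,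
    Complex.conj_ofReal]
  ring

/-- The `d` vectors are independent, so they span the range; the coordinates of a kernel vector of
the compression would lie in the kernel of the matrix. -/
theorem isUnit_compress_of_det_formMatrix_ne_zero [FiniteDimensional ℂ V] [CompleteSpace V]
    {P : V →L[ℂ] V} {d : ℕ} (hP : IsProjectionOfRank P d) {T : V →L[ℂ] V} {v : Fin d → V}
    (hv : ∀ i, v i ∈ P.range) (h : (formMatrix T v).det ≠ 0) : IsUnit (compress P T) := by
  let w : Fin d → P.range := fun i => ⟨v i, hv i⟩
  have hw : LinearIndependent ℂ w :=
    LinearIndependent.of_comp P.range.subtype (linearIndependent_of_det_formMatrix_ne_zero h)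
  have hspan := hw.span_eq_top_of_card_eq_finrank' (by rw [Fintype.card_fin, hP.2])
  have hinj : Function.Injective (compress P T) := by
    refine (injective_iff_map_eq_zero _).mpr fun z hz => ?_
    have hzmem : z ∈ Submodule.span ℂ (Set.range w) := hspan ▸ Submodule.mem_top
    obtain ⟨c, rfl⟩ := (Submodule.mem_span_range_iff_exists_fun ℂ).mp hzmem
    have hz' : P (T (∑ j, c j • v j)) = 0 := by
      have := congrArg Subtype.val hz
      rw [coe_compress_apply hP.1] at this
      simpa [w] using this
    have : (formMatrix T v).mulVec c = 0 := by
      ext i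
      have hPv : P (v i) = v i := IsStarProjection.apply_coe hP.1 ⟨v i, hv i⟩
      rw [formMatrix_mulVec, ← hPv, inner_apply_of_isStarProjection hP.1, hz', inner_zero_right, Pi.zero_apply]
    simp [Matrix.eq_zero_of_mulVec_eq_zero h this]
  rw [ContinuousLinearMap.isUnit_iff_bijective]
  exact ⟨hinj, LinearMap.injective_iff_surjective.mp hinj⟩

end Gram

/-! ### A tuple of vectors good for almost every unitary. -/

section Haar

variable {V : Type*} [NormedAddCommGroup V] [InnerProductSpace ℂ V] [FiniteDimensional ℂ V]
  [CompleteSpace V]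

instance isHaarMeasure_unitaryHaar : (unitaryHaar V).IsHaarMeasure :=
  Measure.isHaarMeasure_haarMeasure ⊤

instance isProbabilityMeasure_unitaryHaar : IsProbabilityMeasure (unitaryHaar V) :=
  ⟨Measure.haarMeasure_self⟩

instance secondCountableTopology_unitary : SecondCountableTopology (unitary (V →L[ℂ] V)) := by
  have : ProperSpace (V →L[ℂ] V) := FiniteDimensional.proper_rclike ℂ _
  infer_instance

theorem star_coe_mul_coe (U : unitary (V →L[ℂ] V)) :
    star (U : V →L[ℂ] V) * (U : V →L[ℂ] V) = 1 := U.2.1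

theorem coe_mul_star_coe (U : unitary (V →L[ℂ] V)) :
    (U : V →L[ℂ] V) * star (U : V →L[ℂ] V) = 1 := U.2.2

theorem star_apply_apply (U : unitary (V →L[ℂ] V)) (v : V) :
    star (U : V →L[ℂ] V) ((U : V →L[ℂ] V) v) = v :=
  DFunLike.congr_fun (star_coe_mul_coe U) v

theorem apply_star_apply (U : unitary (V →L[ℂ] V)) (v : V) :
    (U : V →L[ℂ] V) (star (U : V →L[ℂ] V) v) = v :=
  DFunLike.congr_fun (coe_mul_star_coe U) v

/-- Some tuple of `d` vectors is good for almost every unitary conjugate of each of countably many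
unitary operators. -/
theorem exists_ae_det_formMatrix_ne_zero {ι : Type*} [Countable ι] {d : ℕ}
    (hd : d ≤ finrank ℂ V) (g : ι → unitary (V →L[ℂ] V)) :
    ∃ v : Fin d → V, ∀ᵐ U : unitary (V →L[ℂ] V) ∂(unitaryHaar V), ∀ x,
      (formMatrix (g x : V →L[ℂ] V) fun i => star (U : V →L[ℂ] V) (v i)).det ≠ 0 := by
  let _ : MeasurableSpace V := borel V
  have : BorelSpace V := ⟨rfl⟩
  have : FiniteDimensional ℝ V := FiniteDimensional.complexToReal V
  have : ProperSpace V := FiniteDimensional.proper_rclike ℂ V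
  let ν : Measure (Fin d → V) := Measure.addHaar
  have hcont : ∀ x, Continuous fun q : unitary (V →L[ℂ] V) × (Fin d → V) =>
      (formMatrix (g x : V →L[ℂ] V) fun i => star (q.1 : V →L[ℂ] V) (q.2 i)).det := fun x => by
    refine Continuous.matrix_det (continuous_matrix fun i j => ?_)
    simp only [formMatrix, Matrix.of_apply]
    fun_prop
  have hconj : ∀ (U : unitary (V →L[ℂ] V)) x (v : Fin d → V),
      (formMatrix (g x : V →L[ℂ] V) fun i => star (U : V →L[ℂ] V) (v i)) =
        formMatrix ((U : V →L[ℂ] V) * (g x : V →L[ℂ] V) * star (U : V →L[ℂ] V)) v := fun U x v => by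
    ext i j
    simp only [formMatrix, Matrix.of_apply]
    rw [ContinuousLinearMap.star_eq_adjoint, ContinuousLinearMap.adjoint_inner_left]
    rfl
  -- With `U` fixed, genericity in `v` is available; Fubini below trades it for one `v` and almost
  -- every `U`.
  have hall : ∀ U : unitary (V →L[ℂ] V), ∀ᵐ v ∂ν, ∀ x,
      (formMatrix (g x : V →L[ℂ] V) fun i => star (U : V →L[ℂ] V) (v i)).det ≠ 0 := fun U => by
    refine ae_all_iff.mpr fun x => ?_
    have hinj : Function.Injective ((U : V →L[ℂ] V) * (g x : V →L[ℂ] V) * star (U : V →L[ℂ] V)) := by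
      have : ((U : V →L[ℂ] V) * (g x : V →L[ℂ] V) * star (U : V →L[ℂ] V)) = ((U * g x * star U :
        unitary (V →L[ℂ] V)) : V →L[ℂ] V) := rfl
      rw [this]
      exact Function.LeftInverse.injective (star_apply_apply _)
    obtain ⟨v₀, hv₀⟩ := exists_det_formMatrix_ne_zero hd hinj
    simp only [hconj]
    refine ae_ne_zero_of_polynomial_on_lines ν ?_ (exists_polynomial_det_formMatrix _) hv₀
    have := (hcont x).comp (Continuous.prodMk_right U)
    simpa only [Function.comp_def, hconj] using this
  have hmeas : MeasurableSet {q : unitary (V →L[ℂ] V) × (Fin d → V) | ∀ x,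
      (formMatrix (g x : V →L[ℂ] V) fun i => star (q.1 : V →L[ℂ] V) (q.2 i)).det ≠ 0} := by
    rw [Set.ofPred_forall]
    exact MeasurableSet.iInter fun x => (isOpen_ne_fun (hcont x) continuous_const).measurableSet
  exact ((Measure.ae_ae_comm (μ := unitaryHaar V) (ν := ν)
    (p := fun U v => ∀ x, (formMatrix (g x : V →L[ℂ] V) fun i =>
      star (U : V →L[ℂ] V) (v i)).det ≠ 0) hmeas).mp (Filter.Eventually.of_forall hall)).exists

end Haar

/-! ### Conjugated projections and almost sure invertibility. -/

section Conjugation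

variable {V : Type*} [NormedAddCommGroup V] [InnerProductSpace ℂ V] [FiniteDimensional ℂ V]
  [CompleteSpace V]

theorem conjBy_apply (U : unitary (V →L[ℂ] V)) (P : V →L[ℂ] V) (v : V) :
    conjBy U P v = star (U : V →L[ℂ] V) (P ((U : V →L[ℂ] V) v)) := rfl

/-- The unitary `U` maps the range of `U† P U` isometrically onto the range of `P`. -/
def rangeConjByEquiv (U : unitary (V →L[ℂ] V)) (P : V →L[ℂ] V) :
    (conjBy U P).range ≃ₗᵢ[ℂ] P.range where
  toFun w := ⟨(U : V →L[ℂ] V) w, by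
    obtain ⟨_, v, rfl⟩ := w
    exact ⟨(U : V →L[ℂ] V) v, (apply_star_apply U _).symm⟩⟩
  map_add' v w := Subtype.ext (map_add (U : V →L[ℂ] V) (v : V) (w : V))
  map_smul' c v := Subtype.ext (map_smul (U : V →L[ℂ] V) c (v : V))
  invFun w := ⟨star (U : V →L[ℂ] V) w, by
    obtain ⟨_, v, rfl⟩ := w
    refine ⟨star (U : V →L[ℂ] V) v, ?_⟩
    change star (U : V →L[ℂ] V) (P ((U : V →L[ℂ] V) (star (U : V →L[ℂ] V) v))) = _
    rw [apply_star_apply]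
    rfl⟩
  left_inv w := Subtype.ext (star_apply_apply U w)
  right_inv w := Subtype.ext (apply_star_apply U w)
  norm_map' w := Unitary.norm_map U w

theorem isProjectionOfRank_conjBy (U : unitary (V →L[ℂ] V)) {P : V →L[ℂ] V} {d : ℕ}
    (hP : IsProjectionOfRank P d) : IsProjectionOfRank (conjBy U P) d := by
  refine ⟨⟨?_, ?_⟩, ?_⟩
  · ext v
    change conjBy U P (conjBy U P v) = _
    simp only [conjBy_apply, apply_star_apply, IsStarProjection.apply_apply hP.1]
  · have h : star P = P := hP.1.isSelfAdjoint
    rw [isSelfAdjoint_iff, conjBy, star_mul, star_mul, star_star, h, mul_assoc]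
  · rw [(rangeConjByEquiv U P).toLinearEquiv.finrank_eq, hP.2]

/-- An isometry from the span of `v` onto the range of `P`, which has the same dimension, extends to
a unitary of `V`. -/
theorem exists_unitary_apply_mem_range {P : V →L[ℂ] V} {d : ℕ} (hP : IsProjectionOfRank P d)
    {v : Fin d → V} (hv : LinearIndependent ℂ v) :
    ∃ R : unitary (V →L[ℂ] V), ∀ i, (R : V →L[ℂ] V) (v i) ∈ P.range := by
  let S := Submodule.span ℂ (Set.range v)
  have hS : finrank ℂ S = finrank ℂ P.range := by
    rw [hP.2, finrank_span_eq_card hv, Fintype.card_fin]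
  let e : S ≃ₗᵢ[ℂ] P.range :=
    ((stdOrthonormalBasis ℂ S).reindex (finCongr hS)).equiv (stdOrthonormalBasis ℂ P.range)
      (Equiv.refl _)
  let L : S →ₗᵢ[ℂ] V := P.range.subtypeₗᵢ.comp e.toLinearIsometry
  refine ⟨Unitary.linearIsometryEquiv.symm (L.extend.toLinearIsometryEquiv rfl), fun i => ?_⟩
  change L.extend (v i) ∈ P.range
  have := L.extend_apply ⟨v i, Submodule.subset_span ⟨i, rfl⟩⟩
  rw [show L.extend (v i) = L ⟨v i, _⟩ from this]
  exact (e _).2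

theorem isUnit_smul_op {c : ℂ} (hc : c ≠ 0) {A : V →L[ℂ] V} (hA : IsUnit A) : IsUnit (c • A) :=
  hA.smul (Units.mk0 c hc)

theorem isUnit_minor_of_isUnit_compress {G : Type*} [Group G] [Fintype G]
    (ρ : G →* unitary (V →L[ℂ] V)) {P : V →L[ℂ] V} {d : ℕ} (hd : 0 < d) (hdV : d ≤ finrank ℂ V) (hP : IsProjectionOfRank P d)
    {x : G} (h : IsUnit (compress P (ρ x : V →L[ℂ] V))) : IsUnit (minor ρ P x) := by
  have hd' : (0 : ℝ) < d := by positivity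
  have hD' : (0 : ℝ) < finrank ℂ V := by exact_mod_cast (hd.trans_le hdV)
  have hk : ((√((finrank ℂ V : ℝ) / d) : ℝ) : ℂ) ≠ 0 :=
    Complex.ofReal_ne_zero.mpr (Real.sqrt_pos.mpr (by positivity)).ne'
  rw [minor_eq ρ hP]
  exact isUnit_smul_op hk h

theorem ae_isUnit_minor_conjBy {G : Type*} [Group G] [Fintype G]
    (ρ : G →* unitary (V →L[ℂ] V)) {P : V →L[ℂ] V} {d : ℕ} (hd : 0 < d)
    (hdV : d ≤ finrank ℂ V) (hP : IsProjectionOfRank P d) :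
    ∀ᵐ U ∂(unitaryHaar V), ∀ x : G, IsUnit (minor ρ (conjBy U P) x) := by
  obtain ⟨v, hv⟩ := exists_ae_det_formMatrix_ne_zero hdV ρ
  have hli : LinearIndependent ℂ v := by
    obtain ⟨U, hU⟩ := hv.exists
    exact (linearIndependent_of_det_formMatrix_ne_zero (hU 1)).of_comp
      (star (U : V →L[ℂ] V)).toLinearMap
  obtain ⟨R, hR⟩ := exists_unitary_apply_mem_range hP hli
  -- By left invariance `U` may be replaced by `R U`; since `R` sends the `v i` into the range of
  -- `P`, the vectors `U† v i` lie in the range of `(R U)† P (R U)`.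
  refine (eventually_mul_left_iff (unitaryHaar V) R).mp ?_
  filter_upwards [hv] with U hU x
  have hPU := isProjectionOfRank_conjBy (R * U) hP
  refine isUnit_minor_of_isUnit_compress ρ hd hdV hPU
    (isUnit_compress_of_det_formMatrix_ne_zero hPU (fun i => ?_) (hU x))
  refine ⟨star (U : V →L[ℂ] V) (v i), ?_⟩
  change conjBy (R * U) P (star (U : V →L[ℂ] V) (v i)) = star (U : V →L[ℂ] V) (v i)
  rw [conjBy_apply, Submonoid.coe_mul, star_mul, mul_apply_eq_comp, mul_apply_eq_comp,
    apply_star_apply, IsStarProjection.apply_coe hP.1 ⟨_, hR i⟩, star_apply_apply]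

end Conjugation

/-! ### Isometry invariance and continuity of the polar part. -/

section Transport

variable {H K : Type*} [NormedAddCommGroup H] [InnerProductSpace ℂ H] [CompleteSpace H]
  [NormedAddCommGroup K] [InnerProductSpace ℂ K] [CompleteSpace K]

theorem conjStarAlgEquiv_smul (e : H ≃ₗᵢ[ℂ] K) (c : ℂ) (A : H →L[ℂ] H) :
    e.conjStarAlgEquiv (c • A) = c • e.conjStarAlgEquiv A :=
  map_smul e.conjStarAlgEquiv c A

theorem continuous_smul_op (c : ℂ) : Continuous fun A : H →L[ℂ] H => c • A := by
  fun_prop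

theorem continuousOn_op_mul {X : Type*} [TopologicalSpace X] {f g : X → (H →L[ℂ] H)} {s : Set X}
    (hf : ContinuousOn f s) (hg : ContinuousOn g s) : ContinuousOn (fun x => f x * g x) s :=
  hf.mul hg

theorem isOpen_isUnit_op : IsOpen {A : H →L[ℂ] H | IsUnit A} := Units.isOpen

theorem frobSq_conjStarAlgEquiv (e : H ≃ₗᵢ[ℂ] K) (A : H →L[ℂ] H) :
    frobSq (e.conjStarAlgEquiv A) = frobSq A := by
  rw [frobSq, frobSq, ← map_star, ← map_mul]
  exact congrArg Complex.re (LinearMap.trace_conj' (star A * A : H →L[ℂ] H).toLinearMap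
    e.toLinearEquiv)

theorem continuousOn_nnreal_rpow {s : Set NNReal} (h : 0 ∉ s) (y : ℝ) :
    ContinuousOn (fun x : NNReal => x ^ y) s := fun x hx =>
  (NNReal.continuousAt_rpow_const (Or.inl (by rintro rfl; exact h hx))).continuousWithinAt

theorem polarUnitary_conjStarAlgEquiv (e : H ≃ₗᵢ[ℂ] K) {A : H →L[ℂ] H} (hA : IsUnit A) :
    polarUnitary (e.conjStarAlgEquiv A) = e.conjStarAlgEquiv (polarUnitary A) := by
  have hpos := isStrictlyPositive_star_mul_self hA
  have hcont : Continuous e.conjStarAlgEquiv := by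
    change Continuous fun B : H →L[ℂ] H =>
      (e : H →L[ℂ] K).comp (B.comp (e.symm : K →L[ℂ] H))
    fun_prop
  rw [polarUnitary, polarUnitary, map_mul, CFC.rpow_def, CFC.rpow_def,
    StarAlgHomClass.map_cfc (S := ℂ) e.conjStarAlgEquiv _ _
      (continuousOn_nnreal_rpow (spectrum.zero_notMem _ hpos.isUnit) _) hcont hpos.nonneg
      (by rw [map_mul, map_star]; exact star_mul_self_nonneg _), map_mul, map_star]

/-- The spectrum of `A†A` avoids `0` for invertible `A`, and `x ^ (-1/2)` is continuous away from
`0`. -/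
theorem continuousOn_polarUnitary :
    ContinuousOn (polarUnitary : (H →L[ℂ] H) → (H →L[ℂ] H)) {A | IsUnit A} := by
  refine continuousOn_id.mul ?_
  refine ContinuousOn.cfc_nnreal_of_mem_nhdsSet (s := {0}ᶜ) _ ?_ ?_ ?_ ?_
  · refine isOpen_compl_singleton.mem_nhdsSet.mpr (Set.iUnion₂_subset fun A hA x hx => ?_)
    rintro rfl
    exact spectrum.zero_notMem _ (isStrictlyPositive_star_mul_self hA).isUnit hx
  · fun_prop
  · exact fun A _ => star_mul_self_nonneg A
  · exact continuousOn_nnreal_rpow (by simp) _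

end Transport

/-! ### Integrability of the defect. -/

section Integrability

variable {G : Type*} [Group G] [Fintype G]
  {V : Type*} [NormedAddCommGroup V] [InnerProductSpace ℂ V] [FiniteDimensional ℂ V]
  [CompleteSpace V]

/-- The conjugate representation `x ↦ U ρ(x) U†`. -/
def conjRep (U : unitary (V →L[ℂ] V)) (ρ : G →* unitary (V →L[ℂ] V)) :
    G →* unitary (V →L[ℂ] V) :=
  (MulAut.conj U).toMonoidHom.comp ρ

theorem coe_conjRep_apply (U : unitary (V →L[ℂ] V)) (ρ : G →* unitary (V →L[ℂ] V)) (x : G) :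
    (conjRep U ρ x : V →L[ℂ] V) =
      (U : V →L[ℂ] V) * (ρ x : V →L[ℂ] V) * star (U : V →L[ℂ] V) := rfl

/-- The space on which the minor acts varies with `U`. Conjugating `ρ` instead of `P` keeps it
fixed, so that continuity in `U` makes sense. -/
theorem minor_conjBy (ρ : G →* unitary (V →L[ℂ] V)) {P : V →L[ℂ] V} {d : ℕ}
    (hP : IsProjectionOfRank P d) (U : unitary (V →L[ℂ] V)) (x : G) :
    minor ρ (conjBy U P) x =
      (rangeConjByEquiv U P).symm.conjStarAlgEquiv (minor (conjRep U ρ) P x) := by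
  have hPU := isProjectionOfRank_conjBy U hP
  rw [minor_eq ρ hPU, minor_eq _ hP, conjStarAlgEquiv_smul]
  congr 1

theorem isUnit_minor_conjRep_iff (ρ : G →* unitary (V →L[ℂ] V)) {P : V →L[ℂ] V} {d : ℕ}
    (hP : IsProjectionOfRank P d) (U : unitary (V →L[ℂ] V)) (x : G) :
    IsUnit (minor (conjRep U ρ) P x) ↔ IsUnit (minor ρ (conjBy U P) x) := by
  rw [minor_conjBy ρ hP]
  exact (MulEquiv.isUnit_map (rangeConjByEquiv U P).symm.conjStarAlgEquiv).symm

theorem defect_conjBy (ρ : G →* unitary (V →L[ℂ] V)) {P : V →L[ℂ] V} {d : ℕ}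
    (hP : IsProjectionOfRank P d) (U : unitary (V →L[ℂ] V))
    (hU : ∀ x, IsUnit (minor ρ (conjBy U P) x)) :
    defect ρ (conjBy U P) = defect (conjRep U ρ) P := by
  have hpolar : ∀ x, polarMinor ρ (conjBy U P) x =
      (rangeConjByEquiv U P).symm.conjStarAlgEquiv (polarMinor (conjRep U ρ) P x) := fun x => by
    rw [polarMinor, minor_conjBy ρ hP, polarUnitary_conjStarAlgEquiv _
      ((isUnit_minor_conjRep_iff ρ hP U x).mpr (hU x)), polarMinor]
  simp only [defect, hpolar, ← map_mul, ← map_sub, frobSq_conjStarAlgEquiv]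

theorem continuous_compress (P : V →L[ℂ] V) : Continuous (compress P) := by
  let L : (V →L[ℂ] V) →ₗ[ℂ] (P.range →L[ℂ] P.range) :=
    { toFun := compress P
      map_add' := compress_add P
      map_smul' := fun c T => compress_smul P T c }
  exact L.continuous_of_finiteDimensional

theorem continuous_frobSq : Continuous (frobSq : (V →L[ℂ] V) → ℝ) := by
  have h : Continuous (opTrace V) := (opTrace V).continuous_of_finiteDimensional
  change Continuous fun A : V →L[ℂ] V => (opTrace V (star A * A)).re
  fun_prop

theorem continuous_minor_conjRep (ρ : G →* unitary (V →L[ℂ] V)) (P : V →L[ℂ] V) (x : G) :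
    Continuous fun U => minor (conjRep U ρ) P x := by
  have h : Continuous fun U : unitary (V →L[ℂ] V) => (conjRep U ρ x : V →L[ℂ] V) := by
    simp only [coe_conjRep_apply]
    fun_prop
  exact (continuous_smul_op _).comp ((continuous_compress P).comp h)

theorem continuousOn_defect_conjRep (ρ : G →* unitary (V →L[ℂ] V)) (P : V →L[ℂ] V) :
    ContinuousOn (fun U => defect (conjRep U ρ) P)
      {U | ∀ x, IsUnit (minor (conjRep U ρ) P x)} := by
  have hpolar : ∀ x, ContinuousOn (fun U => polarMinor (conjRep U ρ) P x)
      {U | ∀ x, IsUnit (minor (conjRep U ρ) P x)} := fun x =>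
    continuousOn_polarUnitary.comp (continuous_minor_conjRep ρ P x).continuousOn
      fun U hU => hU x
  refine ContinuousOn.div_const (continuousOn_finsetSum _ fun x _ =>
    continuousOn_finsetSum _ fun y _ => ?_) _
  exact continuous_frobSq.comp_continuousOn
    ((hpolar (x * y)).sub (continuousOn_op_mul (hpolar x) (hpolar y)))

theorem measurableSet_isUnit_minor_conjRep (ρ : G →* unitary (V →L[ℂ] V)) (P : V →L[ℂ] V) :
    MeasurableSet {U | ∀ x, IsUnit (minor (conjRep U ρ) P x)} := by
  rw [Set.ofPred_forall]
  exact MeasurableSet.iInter fun x =>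
    (isOpen_isUnit_op.preimage (continuous_minor_conjRep ρ P x)).measurableSet

theorem integrable_defect_conjBy (ρ : G →* unitary (V →L[ℂ] V))
    (hρ : (toRepresentation ρ).IsIrreducible) {P : V →L[ℂ] V} {d : ℕ} (hd : 0 < d)
    (hdV : d ≤ finrank ℂ V) (hP : IsProjectionOfRank P d) :
    Integrable (fun U => defect ρ (conjBy U P)) (unitaryHaar V) := by
  have hae := ae_isUnit_minor_conjBy ρ hd hdV hP
  have hmem : ∀ᵐ U ∂(unitaryHaar V), U ∈ {U | ∀ x, IsUnit (minor (conjRep U ρ) P x)} := by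
    filter_upwards [hae] with U hU x
    exact (isUnit_minor_conjRep_iff ρ hP U x).mpr (hU x)
  -- Continuity is known only where all minors are invertible; that set is measurable of full
  -- measure, so restricting to it loses nothing.
  have hmeas : AEStronglyMeasurable (fun U => defect (conjRep U ρ) P) (unitaryHaar V) := by
    rw [← Measure.restrict_eq_self_of_ae_mem hmem]
    exact (continuousOn_defect_conjRep ρ P).aestronglyMeasurable
      (measurableSet_isUnit_minor_conjRep ρ P)
  refine Integrable.of_bound (C := 2 * (d : ℝ) * polarFactor ((d : ℝ) / finrank ℂ V))
    (hmeas.congr ?_) ?_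
  · filter_upwards [hae] with U hU
    exact (defect_conjBy ρ hP U hU).symm
  · filter_upwards [hae] with U hU
    rw [Real.norm_of_nonneg (defect_nonneg _ _)]
    exact defect_le ρ hρ hd hdV (isProjectionOfRank_conjBy U hP) hU

end Integrability

/-! ### Existence of projections, the numerical threshold and the conclusion. -/

theorem exists_isProjectionOfRank {V : Type*} [NormedAddCommGroup V] [InnerProductSpace ℂ V]
    [FiniteDimensional ℂ V] [CompleteSpace V] {d : ℕ} (hd : d ≤ finrank ℂ V) :
    ∃ P : V →L[ℂ] V, IsProjectionOfRank P d := by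
  obtain ⟨W, hW, -⟩ := exists_invariant_submodule (0 : End ℂ V) hd
  refine ⟨W.starProjection, isStarProjection_starProjection, ?_⟩
  rw [Submodule.range_starProjection, hW]

theorem polarFactor_lt_one {r : ℝ} (hr : (31 - 2 * √58) / 18 < r) : polarFactor r < 1 := by
  have h58 : √58 ^ 2 = 58 := Real.sq_sqrt (by norm_num)
  have h7 : 7 < √58 := Real.lt_sqrt_of_sq_lt (by norm_num)
  have h8 : √58 < 8 := (Real.sqrt_lt' (by norm_num)).mpr (by norm_num)
  have hr0 : 0 ≤ r := by linarith
  -- With `q = √r`, the equation `polarFactor r = 1` reads `6q² + 4q - 9 = 0`; this is its positive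
  -- root, and its square is the threshold.
  have hs : (√58 - 2) / 6 < √r := Real.lt_sqrt_of_sq_lt (by nlinarith)
  have hrs : √r ^ 2 = r := Real.sq_sqrt hr0
  rw [polarFactor]
  nlinarith

theorem threshold_bounds :
    0.876 ≤ (31 - 2 * √58) / 18 ∧ (31 - 2 * √58) / 18 < (0.877 : ℝ) := by
  have h1 : √58 < 7.616 := (Real.sqrt_lt' (by norm_num)).mpr (by norm_num)
  have h2 : 7.6157 < √58 := Real.lt_sqrt_of_sq_lt (by norm_num)
  constructor <;> norm_num at * <;> linarith

end ApproxRep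

end

theorem theorem5 {G : Type*} [Group G] [Fintype G]
    {V : Type*} [NormedAddCommGroup V] [InnerProductSpace ℂ V] [FiniteDimensional ℂ V]
    [CompleteSpace V]
    (ρ : G →* unitary (V →L[ℂ] V))
    (hρ : (ApproxRep.toRepresentation ρ).IsIrreducible)
    (d : ℕ) (hd : 0 < d) (hdV : d ≤ Module.finrank ℂ V) :
    -- the average over a uniformly random projection `U† P U` of rank `d`
    (∀ P : V →L[ℂ] V, ApproxRep.IsProjectionOfRank P d →
      (∀ᵐ U ∂(ApproxRep.unitaryHaar V), ∀ x : G,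
        IsUnit (ApproxRep.minor ρ (ApproxRep.conjBy U P) x)) ∧
      MeasureTheory.Integrable
        (fun U => ApproxRep.defect ρ (ApproxRep.conjBy U P)) (ApproxRep.unitaryHaar V) ∧
      ∫ U, ApproxRep.defect ρ (ApproxRep.conjBy U P) ∂(ApproxRep.unitaryHaar V) ≤
        2 * (d : ℝ) * ApproxRep.polarFactor ((d : ℝ) / (Module.finrank ℂ V : ℝ))) ∧
    -- a particular projection attaining the bound, better than random for large `d / dim V`
    (∃ P : V →L[ℂ] V, ApproxRep.IsProjectionOfRank P d ∧
      (∀ x : G, IsUnit (ApproxRep.minor ρ P x) ∧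
        ApproxRep.polarMinor ρ P x ∈ unitary (P.range →L[ℂ] P.range)) ∧
      ApproxRep.defect ρ P ≤
        2 * (d : ℝ) * ApproxRep.polarFactor ((d : ℝ) / (Module.finrank ℂ V : ℝ)) ∧
      ((31 - 2 * √58) / 18 < (d : ℝ) / (Module.finrank ℂ V : ℝ) →
        ApproxRep.polarFactor ((d : ℝ) / (Module.finrank ℂ V : ℝ)) < 1 ∧
        1 / (2 * (d : ℝ)) * ApproxRep.defect ρ P ≤
          ApproxRep.polarFactor ((d : ℝ) / (Module.finrank ℂ V : ℝ)))) ∧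
    -- the threshold is `0.876…`
    (0.876 ≤ (31 - 2 * √58) / 18 ∧ (31 - 2 * √58) / 18 < (0.877 : ℝ)) := by
  have hbound : ∀ P : V →L[ℂ] V, ApproxRep.IsProjectionOfRank P d →
      ∀ᵐ U ∂(ApproxRep.unitaryHaar V), ApproxRep.defect ρ (ApproxRep.conjBy U P) ≤
        2 * (d : ℝ) * ApproxRep.polarFactor ((d : ℝ) / (Module.finrank ℂ V : ℝ)) :=
    fun P hP => (ApproxRep.ae_isUnit_minor_conjBy ρ hd hdV hP).mono fun U hU =>
      ApproxRep.defect_le ρ hρ hd hdV (ApproxRep.isProjectionOfRank_conjBy U hP) hU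
  refine ⟨fun P hP => ?_, ?_, ApproxRep.threshold_bounds⟩
  · refine ⟨ApproxRep.ae_isUnit_minor_conjBy ρ hd hdV hP,
      ApproxRep.integrable_defect_conjBy ρ hρ hd hdV hP, ?_⟩
    refine (MeasureTheory.integral_mono_ae (ApproxRep.integrable_defect_conjBy ρ hρ hd hdV hP)
      (MeasureTheory.integrable_const _) (hbound P hP)).trans_eq ?_
    simp
  · obtain ⟨P, hP⟩ := ApproxRep.exists_isProjectionOfRank hdV
    -- Invertibility and the bound both hold almost everywhere for a probability measure, so one
    -- unitary satisfies both.
    obtain ⟨U, hU, hle⟩ :=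
      ((ApproxRep.ae_isUnit_minor_conjBy ρ hd hdV hP).and (hbound P hP)).exists
    refine ⟨ApproxRep.conjBy U P, ApproxRep.isProjectionOfRank_conjBy U hP,
      fun x => ⟨hU x, ApproxRep.polarMinor_mem_unitary ρ (hU x)⟩, hle,
      fun hr => ⟨ApproxRep.polarFactor_lt_one hr, ?_⟩⟩
    have hd' : (0 : ℝ) < 2 * d := by positivity
    rw [one_div, inv_mul_le_iff₀ hd']
    exact hle
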